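/- Let $X$ be a non-empty compact metric space with distance $d$ and let $T\colon X\to X$ be a homeomorphism. Suppose that $(X,T)$ is minimal (for every $x\in X$ the orbit $\{T^nx : n\in\mathbb Z\}$ is dense in $X$) and distal ($\inf_{n\in\mathbb Z} d(T^nx,T^ny)>0$ for all $x\neq y$ in $X$). Let $\mathcal P\subset X^4$ be the set of parallelograms of $X$, that is, the closure in $X^4$ of $$\{(x,T^mx,T^nx,T^{m+n}x) : x\in X,\ m,n\in\mathbb Z\}.$$ A factor of $(X,T)$ is a system $(Y,S)$ ($Y$ compact metrizable, $S$ a homeomorphism of $Y$) with a continuous surjection $p\colon X\to Y$ such that $S\circ p=p\circ T$; it is equicontinuous if the family $(S^n)_{n\in\mathbb Z}$ is uniformly equicontinuous. The maximal equicontinuous factor $\pi\colon X\to Z$ of $(X,T)$ is the equicontinuous factor through which every equicontinuous factor $p\colon X\to Y$ factors, that is, $p=q\circ\pi$ for a factor map $q\colon Z\to Y$. Then $(X,T)$ has a maximal equicontinuous factor, and it can be realized as a rotation $z\mapsto\alpha z$ on a compact metrizable abelian group $Z$. Moreover, for every such realization $\pi\colon X\to Z$ and every $(x_0,x_1,x_2,x_3)\in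 X^4$: 1. $(x_0,x_1,x_2,x_3)\in\mathcal P$ if and only if $\pi(x_0)\,\pi(x_1)^{-1}\,\pi(x_2)^{-1}\,\pi(x_3)=1$ in $Z$. 2. $(x_0,x_1,x_2,x_3)\in\mathcal P$ if and only if there are two sequences of integers $(m_i)$ and $(n_i)$ with $T^{m_i}x_0\to x_1$, $T^{n_i}x_0\to x_2$ and $T^{m_i+n_i}x_0\to x_3$. -/

import Mathlib

open Filter Topology

universe u v

namespace TopDyn

/-- The system `(X, T)` is minimal: every two-sided orbit is dense. -/
def IsMinimalSystem {X : Type u} [TopologicalSpace X] (T : X ≃ₜ X) : Prop :=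
  ∀ x : X, Dense (Set.range fun n : ℤ => (T ^ n) x)

/-- The system `(X, T)` is distal: `inf_n d(Tⁿ x, Tⁿ y) > 0` for all `x ≠ y`. -/
def IsDistalSystem {X : Type u} [MetricSpace X] (T : X ≃ₜ X) : Prop :=
  ∀ x y : X, x ≠ y → 0 < ⨅ n : ℤ, dist ((T ^ n) x) ((T ^ n) y)

/-- The system `(X, T)` is equicontinuous: the family `(Tⁿ)`, `n ∈ ℤ`, is uniformly
equicontinuous. -/
def IsEquicontinuousSystem {X : Type u} [MetricSpace X] (T : X ≃ₜ X) : Prop :=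
  UniformEquicontinuous fun (n : ℤ) (x : X) => (T ^ n) x

/-- `p : X → Y` is a factor map from `(X, T)` to `(Y, S)`. -/
structure IsFactorMap {X : Type u} {Y : Type v} [TopologicalSpace X] [TopologicalSpace Y]
    (T : X ≃ₜ X) (S : Y ≃ₜ Y) (p : X → Y) : Prop where
  continuous : Continuous p
  surjective : Function.Surjective p
  semiconj : ∀ x, p (T x) = S (p x)

/-- `π : X → Z` exhibits `(Z, S)` as the maximal equicontinuous factor of `(X, T)`: it is an
equicontinuous factor, and it lies above every equicontinuous factor `(Y, R)` of `(X, T)`.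
(Every factor of `X` is a quotient of `X`, so it suffices to let `Y` range over the universe
of `X`.) -/
structure IsMaximalEquicontinuousFactor {X : Type u} {Z : Type v}
    [MetricSpace X] [MetricSpace Z] (T : X ≃ₜ X) (S : Z ≃ₜ Z) (π : X → Z) : Prop where
  isFactorMap : IsFactorMap T S π
  equicontinuous : IsEquicontinuousSystem S
  maximal : ∀ (Y : Type u) [MetricSpace Y] [CompactSpace Y] (R : Y ≃ₜ Y) (p : X → Y),
    IsFactorMap T R p → IsEquicontinuousSystem R →
      ∃ q : Z → Y, IsFactorMap S R q ∧ ∀ x, q (π x) = p x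

/-- The set of (dynamical) parallelograms of `(X, T)`: the closure in `X⁴` of the set of the
points `(x, Tᵐ x, Tⁿ x, Tᵐ⁺ⁿ x)`. -/
def parallelograms {X : Type u} [TopologicalSpace X] (T : X ≃ₜ X) : Set (X × X × X × X) :=
  closure {w | ∃ (x : X) (m n : ℤ), w = (x, (T ^ m) x, (T ^ n) x, (T ^ (m + n)) x)}

end TopDyn

/-!
Call a quadruple of points of a `G`-space a parallelogram when it is a limit of quadruples
`(x, g • x, h • x, (g * h) • x)`. For minimal actions this means that the edges `(x₀, x₁)` and
`(x₂, x₃)` are related by the closure of the orbit relation of `G` acting diagonally on `X × X`.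
Distality, through the idempotents of the enveloping semigroup, makes orbit closures partition the
space, and this upgrades the closure of the orbit relation of a normal subgroup of a minimal distal
action from a reflexive symmetric relation to an equivalence relation. Hence parallelograms can be
glued along edges. Identifying `x` with `y` when `(e, x, e, y)` is a parallelogram, the fourth
vertex of a parallelogram is determined by the first three, which turns the quotient of `X` into a
compact abelian group on which `G` acts by translations. In an equicontinuous factor a
parallelogram `(w, x, w, y)` has `p x = p y`, so every such factor is a quotient of this group.

For the sequences, a Baire category argument yields pairs `(x, y)` whose orbit closure contains
every edge parallel to `(x, y)`. Passing through such a pair, every parallelogram with first vertex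
`x` is already a limit of quadruples `(x, g • x, h • x, (g * h) • x)` with the same `x`.
-/

namespace TopDyn

section Topology

variable {ι X Y Z : Type*} [TopologicalSpace X] [TopologicalSpace Y] [TopologicalSpace Z]

theorem mem_of_mem_closure_range {u : ι → X} {x : X} (hx : x ∈ closure (Set.range u)) {f : X → Y}
    (hf : Continuous f) {s : Set Y} (hs : IsClosed s) (hfs : ∀ i, f (u i) ∈ s) : f x ∈ s :=
  hs.closure_subset (map_mem_closure hf hx (Set.mapsTo_range_iff.2 hfs))

theorem exists_mem_closure_range_lift [CompactSpace X] [T2Space Z] {f : X → Z}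
    (hf : Continuous f) (u : ι → X) {z : Z} (hz : z ∈ closure (Set.range fun i => f (u i))) :
    ∃ x ∈ closure (Set.range u), f x = z := by
  rwa [Set.range_comp' f u, ← image_closure_of_isCompact isClosed_closure.isCompact
    hf.continuousOn] at hz

theorem continuous_of_isClosed_graph [CompactSpace Z] {f : Y → Z}
    (hf : IsClosed {p : Y × Z | f p.1 = p.2}) : Continuous f := by
  refine continuous_iff_isClosed.2 fun C hC => ?_
  convert isClosedMap_fst_of_compactSpace _ (hf.inter (hC.preimage continuous_snd)) using 1
  ext y
  simp

theorem isProperMap_quotient_mk [CompactSpace X] {s : Setoid X}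
    (hs : IsClosed {p : X × X | s p.1 p.2}) : IsProperMap (Quotient.mk s) := by
  refine isProperMap_iff_isClosedMap_and_compact_fibers.2
    ⟨continuous_quotient_mk', fun C hC => ?_, Quotient.mk_surjective.forall.2 fun x => ?_⟩
  · have saturation_eq : Quotient.mk s ⁻¹' (Quotient.mk s '' C) =
        Prod.snd '' ({p : X × X | s p.1 p.2} ∩ Prod.fst ⁻¹' C) := by
      ext y
      simp [and_comm, Quotient.eq]
    exact isQuotientMap_quotient_mk'.isClosed_preimage.1 <| saturation_eq ▸
      isClosedMap_snd_of_compactSpace _ (hs.inter (hC.preimage continuous_fst))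
  · have fiber_eq : Quotient.mk s ⁻¹' {Quotient.mk s x} =
        (fun y => (y, x)) ⁻¹' {p | s p.1 p.2} := by
      ext y
      simp [Quotient.eq]
    exact fiber_eq ▸ (hs.preimage (by fun_prop)).isCompact

theorem t2Space_quotient_of_isClosed [CompactSpace X] {s : Setoid X}
    (hs : IsClosed {p : X × X | s p.1 p.2}) : T2Space (Quotient s) := by
  have hproper := isProperMap_quotient_mk hs
  refine t2_iff_isClosed_diagonal.2 ?_
  convert (hproper.prodMap hproper).isClosedMap _ hs using 1
  ext ⟨a, b⟩
  induction a, b using Quotient.inductionOn₂ with | _ x y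
  simp only [Set.mem_diagonal_iff, Set.mem_image, Prod.map, Prod.mk.injEq, Prod.exists]
  exact ⟨fun h => ⟨x, y, Quotient.exact h, rfl, rfl⟩,
    fun ⟨_, _, h, hx, hy⟩ => hx ▸ hy ▸ Quotient.sound h⟩

/-- `C(Z, ℝ)` embeds isometrically into the separable space `C(X, ℝ)`, and a dense sequence in it
separates the points of `Z`. -/
theorem metrizableSpace_of_surjective [CompactSpace X] [R1Space X] [SecondCountableTopology X]
    [T2Space Z] {f : X → Z} (hf : Continuous f) (hsurj : Function.Surjective f) :
    TopologicalSpace.MetrizableSpace Z := by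
  have : CompactSpace Z := hsurj.compactSpace hf
  have isometry_comp : Isometry fun g : C(Z, ℝ) => g.comp ⟨f, hf⟩ :=
    Isometry.of_dist_eq fun g h => by
      simp only [ContinuousMap.dist_eq_iSup]
      exact hsurj.iSup_comp fun z => dist (g z) (h z)
  have := isometry_comp.isEmbedding.secondCountableTopology
  refine Metric.PiNatEmbed.TopologicalSpace.MetrizableSpace.of_countable_separating
    (fun n => TopologicalSpace.denseSeq C(Z, ℝ) n) (fun n => ContinuousMap.continuous _)
    fun z w hzw => ?_
  obtain ⟨g, hg, hgzw⟩ := separatesPoints_continuous_of_t35Space hzw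
  exact (TopologicalSpace.denseRange_denseSeq C(Z, ℝ)).exists_mem_open
    (isOpen_ne_fun (continuous_eval_const z) (continuous_eval_const w)) ⟨⟨g, hg⟩, hgzw⟩

end Topology

section DistalAction

open MulAction

variable {G H X Y : Type*}

/-- An action is distal if no orbit of a pair of distinct points accumulates at the diagonal. -/
class IsDistalAction (G X : Type*) [SMul G X] [TopologicalSpace X] : Prop where
  eq_of_mem_closure_orbit : ∀ ⦃x y z : X⦄, (z, z) ∈ closure (orbit G (x, y)) → x = y

/-- The componentwise action of `G × H` on `X × Y`, as opposed to the diagonal action of a single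
monoid on `X × Y` provided by `Prod.mulAction`. -/
scoped instance componentwiseMulAction [Monoid G] [Monoid H] [MulAction G X] [MulAction H Y] :
    MulAction (G × H) (X × Y) where
  smul g x := (g.1 • x.1, g.2 • x.2)
  one_smul x := Prod.ext (one_smul G x.1) (one_smul H x.2)
  mul_smul g h x := Prod.ext (mul_smul g.1 h.1 x.1) (mul_smul g.2 h.2 x.2)

variable [TopologicalSpace X] [TopologicalSpace Y]

variable [Monoid G] [MulAction G X]

instance [ContinuousConstSMul G X] [Monoid H] [MulAction H Y] [ContinuousConstSMul H Y] :
    ContinuousConstSMul (G × H) (X × Y) where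
  continuous_const_smul g := (continuous_const_smul g.1).prodMap (continuous_const_smul g.2)

instance [IsMinimal G X] [Monoid H] [MulAction H Y] [IsMinimal H Y] :
    IsMinimal (G × H) (X × Y) where
  dense_orbit x := (denseRange_smul G x.1).prodMap (denseRange_smul H x.2)

instance [IsDistalAction G X] [Monoid H] [MulAction H Y] [IsDistalAction H Y] :
    IsDistalAction (G × H) (X × Y) where
  eq_of_mem_closure_orbit := by
    rintro ⟨x, x'⟩ ⟨y, y'⟩ ⟨z, z'⟩ h
    refine Prod.ext (IsDistalAction.eq_of_mem_closure_orbit (G := G) (z := z) ?_)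
      (IsDistalAction.eq_of_mem_closure_orbit (G := H) (z := z') ?_)
    · exact mem_of_mem_closure_range h (f := fun p => (p.1.1, p.2.1)) (by fun_prop)
        isClosed_closure fun g => subset_closure ⟨g.1, rfl⟩
    · exact mem_of_mem_closure_range h (f := fun p => (p.1.2, p.2.2)) (by fun_prop)
        isClosed_closure fun g => subset_closure ⟨g.2, rfl⟩

instance [MulAction G Y] [IsDistalAction G X] [IsDistalAction G Y] : IsDistalAction G (X × Y) where
  eq_of_mem_closure_orbit := by
    rintro ⟨x, x'⟩ ⟨y, y'⟩ ⟨z, z'⟩ h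
    refine Prod.ext (IsDistalAction.eq_of_mem_closure_orbit (G := G) (z := z) ?_)
      (IsDistalAction.eq_of_mem_closure_orbit (G := G) (z := z') ?_)
    · exact mem_of_mem_closure_range h (f := fun p => (p.1.1, p.2.1)) (by fun_prop)
        isClosed_closure fun g => subset_closure ⟨g, rfl⟩
    · exact mem_of_mem_closure_range h (f := fun p => (p.1.2, p.2.2)) (by fun_prop)
        isClosed_closure fun g => subset_closure ⟨g, rfl⟩

instance {G : Type*} [Group G] [MulAction G X] [ContinuousConstSMul G X] (K : Subgroup G) :
    ContinuousConstSMul K X where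
  continuous_const_smul g := continuous_const_smul (g : G)

instance {G : Type*} [Group G] [MulAction G X] [IsDistalAction G X] (K : Subgroup G) :
    IsDistalAction K X where
  eq_of_mem_closure_orbit _ _ _ h := IsDistalAction.eq_of_mem_closure_orbit (G := G) <|
    mem_of_mem_closure_range h continuous_id isClosed_closure fun g => subset_closure ⟨(g : G), rfl⟩

theorem mem_closure_orbit_trans [ContinuousConstSMul G X] {x y z : X}
    (hy : y ∈ closure (orbit G x)) (hz : z ∈ closure (orbit G y)) : z ∈ closure (orbit G x) :=
  mem_of_mem_closure_range hz continuous_id isClosed_closure fun g =>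
    mem_of_mem_closure_range hy (continuous_const_smul g) isClosed_closure fun h =>
      subset_closure ⟨g * h, mul_smul g h x⟩

theorem exists_mk_mem_closure_orbit [MulAction G Y] [CompactSpace X] [T2Space X] [CompactSpace Y]
    {x z : X} (h : z ∈ closure (orbit G x)) (y : Y) :
    ∃ y', (z, y') ∈ closure (orbit G (x, y)) := by
  obtain ⟨⟨_, y'⟩, hy', rfl⟩ :=
    exists_mem_closure_range_lift continuous_fst (fun g : G => g • (x, y)) h
  exact ⟨y', hy'⟩

variable (G X) in
/-- The Ellis enveloping semigroup: the pointwise closure of the acting monoid in the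
self-maps of `X`. -/
def envelopingSemigroup : Set (X → X) :=
  closure (Set.range fun (g : G) (x : X) => g • x)

theorem apply_mem_closure_orbit {p : X → X} (hp : p ∈ envelopingSemigroup G X) (x : X) :
    p x ∈ closure (orbit G x) :=
  mem_of_mem_closure_range hp (f := fun p => p x) (continuous_apply x) isClosed_closure fun g =>
    subset_closure (mem_orbit x g)

theorem exists_mem_envelopingSemigroup_apply_eq [CompactSpace X] [T2Space X] {x y : X}
    (h : y ∈ closure (orbit G x)) : ∃ p ∈ envelopingSemigroup G X, p x = y :=
  exists_mem_closure_range_lift (f := fun p : X → X => p x) (continuous_apply x)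
    (fun (g : G) (x : X) => g • x) h

theorem continuous_comp_right (q : X → X) : Continuous fun p : X → X => p ∘ q :=
  continuous_pi fun x => continuous_apply (q x)

theorem comp_mem_envelopingSemigroup [ContinuousConstSMul G X] {p q : X → X}
    (hp : p ∈ envelopingSemigroup G X) (hq : q ∈ envelopingSemigroup G X) :
    p ∘ q ∈ envelopingSemigroup G X := by
  refine mem_of_mem_closure_range hp (continuous_comp_right q) isClosed_closure fun g => ?_
  refine mem_of_mem_closure_range hq (f := fun q x => g • q x) (by fun_prop) isClosed_closure
    fun h => ?_
  exact subset_closure ⟨g * h, funext (mul_smul g h)⟩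

theorem eq_id_of_comp_self_eq [IsDistalAction G X] {p : X → X}
    (hp : p ∈ envelopingSemigroup G X) (hidem : p ∘ p = p) : p = id := by
  refine funext fun x => (IsDistalAction.eq_of_mem_closure_orbit (G := G) (z := p x) ?_).symm
  have orbit_accumulates : (p x, p (p x)) ∈ closure (orbit G (x, p x)) :=
    mem_of_mem_closure_range hp (f := fun q => (q x, q (p x))) (by fun_prop) isClosed_closure
      fun g => subset_closure (mem_orbit (x, p x) g)
  rwa [show p (p x) = p x from congrFun hidem x] at orbit_accumulates

/-- The left ideal generated by `q` contains an idempotent by Ellis' theorem. -/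
theorem exists_comp_eq_id [CompactSpace X] [T2Space X] [ContinuousConstSMul G X]
    [IsDistalAction G X] {q : X → X} (hq : q ∈ envelopingSemigroup G X) :
    ∃ p ∈ envelopingSemigroup G X, p ∘ q = id := by
  let : TopologicalSpace (Function.End X) := (Pi.topologicalSpace : TopologicalSpace (X → X))
  have : T2Space (Function.End X) := (Pi.t2Space : T2Space (X → X))
  obtain ⟨_, ⟨p, hp, rfl⟩, hidem⟩ := exists_idempotent_in_compact_subsemigroup
    (M := Function.End X) continuous_comp_right
    ((fun p : X → X => p ∘ q) '' envelopingSemigroup G X)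
    ⟨_, q, hq, rfl⟩ (isClosed_closure.isCompact.image (continuous_comp_right q)) (by
      rintro _ ⟨a, ha, rfl⟩ _ ⟨b, hb, rfl⟩
      exact ⟨a ∘ q ∘ b, comp_mem_envelopingSemigroup ha (comp_mem_envelopingSemigroup hq hb), rfl⟩)
  exact ⟨p, hp, eq_id_of_comp_self_eq (comp_mem_envelopingSemigroup hp hq) hidem⟩

theorem mem_closure_orbit_symm [CompactSpace X] [T2Space X] [ContinuousConstSMul G X]
    [IsDistalAction G X] {x y : X} (h : y ∈ closure (orbit G x)) : x ∈ closure (orbit G y) := by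
  obtain ⟨q, hq, rfl⟩ := exists_mem_envelopingSemigroup_apply_eq h
  obtain ⟨p, hp, hpq⟩ := exists_comp_eq_id hq
  simpa only [show p (q x) = x from congrFun hpq x] using apply_mem_closure_orbit hp (q x)

end DistalAction

section OrbitRelation

open MulAction

variable {G W : Type*} [TopologicalSpace W]

variable (G W) in
/-- The closure in `W × W` of the orbit equivalence relation of an action on `W`. -/
def orbitRelClosure [SMul G W] : Set (W × W) :=
  closure (Set.range fun p : G × W => (p.2, p.1 • p.2))

theorem mk_smul_mem_orbitRelClosure [SMul G W] (g : G) (w : W) :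
    (w, g • w) ∈ orbitRelClosure G W :=
  subset_closure ⟨(g, w), rfl⟩

theorem orbitRelClosure_refl [Monoid G] [MulAction G W] (w : W) : (w, w) ∈ orbitRelClosure G W := by
  simpa only [one_smul] using mk_smul_mem_orbitRelClosure (1 : G) w

theorem orbitRelClosure_symm [Group G] [MulAction G W] {a b : W}
    (h : (a, b) ∈ orbitRelClosure G W) : (b, a) ∈ orbitRelClosure G W :=
  mem_of_mem_closure_range h continuous_swap isClosed_closure fun p => by
    simpa only [inv_smul_smul, Prod.swap_prod_mk] using
      mk_smul_mem_orbitRelClosure p.1⁻¹ (p.1 • p.2)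

theorem eventually_residual_mem_closure_orbit [SMul G W] [ContinuousConstSMul G W]
    [SecondCountableTopology W] :
    ∀ᶠ a in residual W, ∀ b, (a, b) ∈ orbitRelClosure G W → b ∈ closure (orbit G a) := by
  let visitors (U : Set W) : Set W := {a | ∃ g : G, g • a ∈ U}
  have isOpen_visitors {U : Set W} (hU : IsOpen U) : IsOpen (visitors U) := by
    simp only [visitors, Set.ofPred_exists]
    exact isOpen_iUnion fun g => hU.preimage (continuous_const_smul g)
  have generic : ∀ᶠ a in residual W, ∀ U ∈ TopologicalSpace.countableBasis W,
      a ∈ closure (visitors U) → a ∈ visitors U :=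
    (eventually_countable_ball (TopologicalSpace.countable_countableBasis W)).2 fun U hU =>
      (closure_residualEq (isOpen_visitors
        (TopologicalSpace.isOpen_of_mem_countableBasis hU)).isLocallyClosed).mem_iff.mono
          fun _ h => h.1
  filter_upwards [generic] with a ha b hab
  refine (TopologicalSpace.isBasis_countableBasis W).mem_closure_iff.2 fun U hU hbU => ?_
  obtain ⟨g, hg⟩ := ha U hU <| mem_closure_iff.2 fun V hV haV => by
    obtain ⟨_, ⟨hvV, hvU⟩, ⟨⟨g, v⟩, rfl⟩⟩ := mem_closure_iff.1 hab (V ×ˢ U)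
      (hV.prod (TopologicalSpace.isOpen_of_mem_countableBasis hU)) ⟨haV, hbU⟩
    exact ⟨v, hvV, g, hvU⟩
  exact ⟨g • a, hg, g, rfl⟩

variable [Group G] [MulAction G W] {K : Subgroup G}

/-- The pairs of elements of a group that are congruent modulo a normal subgroup. -/
def congruenceSubgroup (K : Subgroup G) [K.Normal] : Subgroup (G × G) :=
  ((QuotientGroup.mk' K).comp (MonoidHom.fst G G)).eqLocus
    ((QuotientGroup.mk' K).comp (MonoidHom.snd G G))

theorem mem_congruenceSubgroup [K.Normal] {g : G × G} :
    g ∈ congruenceSubgroup K ↔ g.1⁻¹ * g.2 ∈ K :=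
  QuotientGroup.eq

theorem mk_smul_smul_mem_orbitRelClosure [K.Normal] [ContinuousConstSMul G W] {g h : G}
    (hgh : g⁻¹ * h ∈ K) {a b : W} (hab : (a, b) ∈ orbitRelClosure K W) :
    (g • a, h • b) ∈ orbitRelClosure K W := by
  refine mem_of_mem_closure_range hab (f := fun p : W × W => (g • p.1, h • p.2)) (by fun_prop)
    isClosed_closure fun ⟨k, w⟩ => ?_
  have hk : h * k * g⁻¹ ∈ K := by
    have hk := ‹K.Normal›.conj_mem _ (mul_mem hgh k.2) g
    simpa only [mul_assoc, mul_inv_cancel_left] using hk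
  have := mk_smul_mem_orbitRelClosure (⟨h * k * g⁻¹, hk⟩ : K) (g • w)
  simpa only [Subgroup.smul_def, mul_smul, inv_smul_smul] using this

theorem mem_closure_orbit_congruenceSubgroup [K.Normal] [ContinuousConstSMul G W] [IsMinimal G W]
    {p : W × W} (hp : p ∈ orbitRelClosure K W) (w : W) :
    p ∈ closure (orbit (congruenceSubgroup K) (w, w)) := by
  refine mem_of_mem_closure_range hp continuous_id isClosed_closure fun ⟨k, v⟩ => ?_
  refine mem_of_mem_closure_range (dense_orbit G w v) (f := fun v => (v, k • v)) (by fun_prop)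
    isClosed_closure fun g => subset_closure ⟨⟨(g, k * g), ?_⟩, ?_⟩
  · simpa only [mem_congruenceSubgroup, mul_assoc, inv_inv] using
      ‹K.Normal›.conj_mem _ k.2 g⁻¹
  · exact Prod.ext rfl (mul_smul _ _ _)

/-- `(a, b, c)` can be moved close to `(a, a, a)` by elements of `G³` congruent modulo `K`. By
distality such moves can be undone, and undoing them leads from `(a, a, a)` to `(a, b, c)`. -/
theorem orbitRelClosure_trans [K.Normal] [CompactSpace W] [T2Space W] [ContinuousConstSMul G W]
    [IsMinimal G W] [IsDistalAction G W] {a b c : W} (hab : (a, b) ∈ orbitRelClosure K W)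
    (hbc : (b, c) ∈ orbitRelClosure K W) : (a, c) ∈ orbitRelClosure K W := by
  let L : Subgroup ((G × G) × G) := (congruenceSubgroup K).comap (MonoidHom.fst (G × G) G) ⊓
    (congruenceSubgroup K).comap
      (((MonoidHom.snd G G).comp (MonoidHom.fst (G × G) G)).prod (MonoidHom.snd (G × G) G))
  obtain ⟨⟨_, c'⟩, hc', rfl⟩ := exists_mem_closure_range_lift continuous_fst
    (fun g : congruenceSubgroup K => (g • (a, b), (g : G × G).2 • c))
    (mem_closure_orbit_symm (mem_closure_orbit_congruenceSubgroup hab a))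
  have hac' : (a, c') ∈ orbitRelClosure K W :=
    mem_of_mem_closure_range hc' (f := fun v => (v.1.2, v.2)) (by fun_prop) isClosed_closure
      fun g => mk_smul_smul_mem_orbitRelClosure (by simp) hbc
  have collapse_first_pair : ((a, a), c') ∈ closure (orbit L ((a, b), c)) :=
    mem_of_mem_closure_range hc' continuous_id isClosed_closure fun g =>
      subset_closure ⟨⟨(g, (g : G × G).2), g.2, by simp [mem_congruenceSubgroup]⟩, rfl⟩
  have collapse_last_pair : ((a, a), a) ∈ closure (orbit L ((a, a), c')) :=
    mem_of_mem_closure_range (mem_closure_orbit_symm (mem_closure_orbit_congruenceSubgroup hac' a))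
      (f := fun v : W × W => ((v.1, v.1), v.2)) (by fun_prop) isClosed_closure fun g =>
        subset_closure ⟨⟨((g.1.1, g.1.1), g.1.2), by simp [mem_congruenceSubgroup], g.2⟩, rfl⟩
  have expand := mem_closure_orbit_symm
    (mem_closure_orbit_trans collapse_first_pair collapse_last_pair)
  refine mem_of_mem_closure_range expand (f := fun v => (v.1.1, v.2)) (by fun_prop)
    isClosed_closure fun ⟨⟨⟨g, h⟩, l⟩, hgh, hhl⟩ =>
      mk_smul_smul_mem_orbitRelClosure ?_ (orbitRelClosure_refl a)
  replace hgh : g⁻¹ * h ∈ K := mem_congruenceSubgroup.1 hgh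
  replace hhl : h⁻¹ * l ∈ K := mem_congruenceSubgroup.1 hhl
  simpa only [mul_assoc, mul_inv_cancel_left] using mul_mem hgh hhl

end OrbitRelation

section Parallelogram

open MulAction

variable {G X : Type*} [CommGroup G] [MulAction G X]

variable (G) in
/-- The elements `((g, h), g * h)`: the moves of a parallelogram that fix its first vertex. -/
def faceSubgroup : Subgroup ((G × G) × G) :=
  mulMonoidHom.graph

theorem mk_smul_first_mem_orbit_faceSubgroup (g : G) (x y z : X) :
    ((g • x, y), g • z) ∈ orbit (faceSubgroup G) ((x, y), z) :=
  ⟨⟨((g, 1), g), mul_one g⟩, congrArg (fun y => ((g • x, y), g • z)) (one_smul G y)⟩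

theorem mk_smul_second_mem_orbit_faceSubgroup (g : G) (x y z : X) :
    ((x, g • y), g • z) ∈ orbit (faceSubgroup G) ((x, y), z) :=
  ⟨⟨((1, g), g), one_mul g⟩, congrArg (fun x => ((x, g • y), g • z)) (one_smul G x)⟩

variable [TopologicalSpace X]

variable (G) in
/-- `(x₀, x₁, x₂, x₃)` is a parallelogram of the action of `G` on `X` when it is a limit of
quadruples `(x, g • x, h • x, (g * h) • x)`. -/
def IsParallelogram (x₀ x₁ x₂ x₃ : X) : Prop :=
  (x₀, x₁, x₂, x₃) ∈
    closure (Set.range fun p : X × G × G => (p.1, p.2.1 • p.1, p.2.2 • p.1, (p.2.1 * p.2.2) • p.1))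

theorem isClosed_setOf_isParallelogram :
    IsClosed {w : X × X × X × X | IsParallelogram G w.1 w.2.1 w.2.2.1 w.2.2.2} :=
  isClosed_closure

theorem IsParallelogram.flip {x₀ x₁ x₂ x₃ : X} (h : IsParallelogram G x₀ x₁ x₂ x₃) :
    IsParallelogram G x₀ x₂ x₁ x₃ :=
  mem_of_mem_closure_range h (f := fun w => (w.1, w.2.2.1, w.2.1, w.2.2.2)) (by fun_prop)
    isClosed_closure fun p => subset_closure ⟨(p.1, p.2.2, p.2.1), by simp only [mul_comm]⟩

theorem IsParallelogram.smul_opposite [ContinuousConstSMul G X] (g : G) {x₀ x₁ x₂ x₃ : X}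
    (h : IsParallelogram G x₀ x₁ x₂ x₃) : IsParallelogram G x₀ (g • x₁) x₂ (g • x₃) :=
  mem_of_mem_closure_range h (f := fun w => (w.1, g • w.2.1, w.2.2.1, g • w.2.2.2)) (by fun_prop)
    isClosed_closure fun ⟨x, a, b⟩ =>
      subset_closure ⟨(x, g * a, b), by simp only [mul_smul]⟩

variable (G) in
theorem exists_isParallelogram [CompactSpace X] [T2Space X] [IsMinimal G X] (x₀ x₁ x₂ : X) :
    ∃ x₃, IsParallelogram G x₀ x₁ x₂ x₃ := by
  obtain ⟨⟨_, x₃⟩, hx₃, rfl⟩ := exists_mem_closure_range_lift continuous_fst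
    (fun g : G × G => (g • (x₀, x₀), (g.1 * g.2) • x₀)) (dense_orbit (G × G) (x₀, x₀) (x₁, x₂))
  exact ⟨x₃, mem_of_mem_closure_range hx₃ (f := fun w => (x₀, w.1.1, w.1.2, w.2)) (by fun_prop)
    isClosed_closure fun g => subset_closure ⟨(x₀, g), rfl⟩⟩

section Minimal

variable [ContinuousConstSMul G X] [IsMinimal G X]

theorem isParallelogram_smul_smul (x y : X) (g : G) : IsParallelogram G x y (g • x) (g • y) :=
  mem_of_mem_closure_range (dense_orbit G x y) (f := fun y => (x, y, g • x, g • y)) (by fun_prop)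
    isClosed_closure fun h => subset_closure ⟨(x, h, g), by simp only [mul_comm h, mul_smul]⟩

theorem isParallelogram_refl (x y : X) : IsParallelogram G x y x y := by
  simpa only [one_smul] using isParallelogram_smul_smul x y (1 : G)

theorem isParallelogram_iff_mem_orbitRelClosure {x₀ x₁ x₂ x₃ : X} :
    IsParallelogram G x₀ x₁ x₂ x₃ ↔
      ((x₀, x₁), (x₂, x₃)) ∈ orbitRelClosure (MonoidHom.id G).graph (X × X) := by
  constructor <;> intro h
  · refine mem_of_mem_closure_range h (f := fun w => ((w.1, w.2.1), (w.2.2.1, w.2.2.2)))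
      (by fun_prop) isClosed_closure fun ⟨x, g, h⟩ => ?_
    have h_translate :
        ((x, g • x), (h • x, h • g • x)) ∈ orbitRelClosure (MonoidHom.id G).graph _ :=
      mk_smul_mem_orbitRelClosure (⟨(h, h), rfl⟩ : (MonoidHom.id G).graph) (x, g • x)
    simpa only [mul_comm g, mul_smul] using h_translate
  · refine mem_of_mem_closure_range h (f := fun w => (w.1.1, w.1.2, w.2.1, w.2.2))
      (by fun_prop) isClosed_closure fun ⟨⟨⟨g, h⟩, hgh⟩, x, y⟩ => ?_
    obtain rfl : g = h := hgh
    exact isParallelogram_smul_smul x y g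

theorem IsParallelogram.symm {x₀ x₁ x₂ x₃ : X} (h : IsParallelogram G x₀ x₁ x₂ x₃) :
    IsParallelogram G x₂ x₃ x₀ x₁ :=
  isParallelogram_iff_mem_orbitRelClosure.2
    (orbitRelClosure_symm (isParallelogram_iff_mem_orbitRelClosure.1 h))

theorem IsParallelogram.swap {x₀ x₁ x₂ x₃ : X} (h : IsParallelogram G x₀ x₁ x₂ x₃) :
    IsParallelogram G x₁ x₀ x₃ x₂ :=
  h.flip.symm.flip

end Minimal

section Distal

variable [CompactSpace X] [T2Space X] [ContinuousConstSMul G X] [IsMinimal G X]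
  [IsDistalAction G X]

theorem IsParallelogram.trans {x₀ x₁ x₂ x₃ x₄ x₅ : X} (h : IsParallelogram G x₀ x₁ x₂ x₃)
    (h' : IsParallelogram G x₂ x₃ x₄ x₅) : IsParallelogram G x₀ x₁ x₄ x₅ := by
  rw [isParallelogram_iff_mem_orbitRelClosure] at h h' ⊢
  exact orbitRelClosure_trans h h'

theorem isParallelogram_congr_right {x₀ x₁ x₂ x₃ y : X} (h : IsParallelogram G x₀ x₁ x₂ x₃)
    (e : X) : IsParallelogram G x₀ x₁ x₂ y ↔ IsParallelogram G e x₃ e y := by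
  have h_edge : IsParallelogram G x₀ x₁ x₂ y ↔ IsParallelogram G x₂ x₃ x₂ y :=
    ⟨h.symm.trans, h.trans⟩
  have h_base : IsParallelogram G e e x₂ x₂ := (isParallelogram_refl e x₂).flip
  rw [h_edge]
  exact ⟨fun hy => (h_base.trans hy.flip).flip, fun hy => (h_base.symm.trans hy.flip).flip⟩

theorem exists_generic_partner [SecondCountableTopology X] (x : X) :
    ∃ y, ∀ x₂ x₃, IsParallelogram G x y x₂ x₃ → (x₂, x₃) ∈ closure (orbit G (x, y)) := by
  have : Nonempty X := ⟨x⟩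
  obtain ⟨⟨a, b⟩, generic⟩ := (dense_of_mem_residual
    (eventually_residual_mem_closure_orbit (G := (MonoidHom.id G).graph) (W := X × X))).nonempty
  obtain ⟨y, hy⟩ := exists_mk_mem_closure_orbit (dense_orbit G a x) b
  have habxy : IsParallelogram G a b x y :=
    mem_of_mem_closure_range hy (f := fun p => (a, b, p)) (by fun_prop) isClosed_closure fun g =>
      isParallelogram_smul_smul a b g
  refine ⟨y, fun x₂ x₃ h => mem_closure_orbit_trans (mem_closure_orbit_symm hy) ?_⟩
  refine mem_of_mem_closure_range
    (generic (x₂, x₃) (isParallelogram_iff_mem_orbitRelClosure.1 (habxy.trans h))) continuous_id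
    isClosed_closure fun ⟨⟨g, h⟩, hgh⟩ => ?_
  obtain rfl : g = h := hgh
  exact subset_closure (mem_orbit (a, b) g)

theorem IsParallelogram.mem_closure_orbit_faceSubgroup [SecondCountableTopology X]
    {x x₁ x₂ x₃ : X} (h : IsParallelogram G x x₁ x₂ x₃) :
    ((x₁, x₂), x₃) ∈ closure (orbit (faceSubgroup G) ((x, x), x)) := by
  obtain ⟨y, generic⟩ := exists_generic_partner (G := G) x
  obtain ⟨z, hz⟩ := exists_mk_mem_closure_orbit (dense_orbit G x₁ y) x₃
  have hxyz : IsParallelogram G x y x₂ z :=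
    mem_of_mem_closure_range hz (f := fun p => (x, p.1, x₂, p.2)) (by fun_prop) isClosed_closure
      fun g => h.smul_opposite g
  have move_first : ((y, x), y) ∈ closure (orbit (faceSubgroup G) ((x, x), x)) :=
    mem_of_mem_closure_range (dense_orbit G x y) (f := fun y => ((y, x), y)) (by fun_prop)
      isClosed_closure fun g => subset_closure (mk_smul_first_mem_orbit_faceSubgroup g x x x)
  have move_second : ((y, x₂), z) ∈ closure (orbit (faceSubgroup G) ((y, x), y)) :=
    mem_of_mem_closure_range (generic x₂ z hxyz) (f := fun p => ((y, p.1), p.2)) (by fun_prop)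
      isClosed_closure fun g => subset_closure (mk_smul_second_mem_orbit_faceSubgroup g y x y)
  have move_back : ((x₁, x₂), x₃) ∈ closure (orbit (faceSubgroup G) ((y, x₂), z)) :=
    mem_closure_orbit_symm <|
      mem_of_mem_closure_range hz (f := fun p => ((p.1, x₂), p.2)) (by fun_prop)
        isClosed_closure fun g => subset_closure (mk_smul_first_mem_orbit_faceSubgroup g x₁ x₂ x₃)
  exact mem_closure_orbit_trans (mem_closure_orbit_trans move_first move_second) move_back

end Distal

end Parallelogram

section ParallelogramGroup

open MulAction

variable {G X : Type*} [CommGroup G] [MulAction G X] [TopologicalSpace X] [CompactSpace X]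
  [T2Space X] [ContinuousConstSMul G X] [IsMinimal G X] [IsDistalAction G X]

variable (G) in
/-- The equivalence relation identifying `x` and `y` when `(e, x, e, y)` is a parallelogram. -/
def parallelogramSetoid (e : X) : Setoid X where
  r x y := IsParallelogram G e x e y
  iseqv := ⟨isParallelogram_refl e, IsParallelogram.symm, IsParallelogram.trans⟩

variable (G) in
/-- The quotient of `X` by `parallelogramSetoid G e`, made into a compact abelian group in which
`x₀ * x₁⁻¹ * x₂⁻¹ * x₃ = 1` expresses that `(x₀, x₁, x₂, x₃)` is a parallelogram. The base point `e`
only selects the neutral element. -/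
def ParallelogramGroup (e : X) : Type _ :=
  Quotient (parallelogramSetoid G e)

namespace ParallelogramGroup

variable {e : X}

variable (G e) in
/-- The quotient map onto `ParallelogramGroup G e`. -/
def mk (x : X) : ParallelogramGroup G e :=
  Quotient.mk (parallelogramSetoid G e) x

theorem mk_surjective : Function.Surjective (mk G e) :=
  Quotient.mk_surjective

theorem mk_eq_mk_iff {x y : X} : mk G e x = mk G e y ↔ IsParallelogram G e x e y :=
  Quotient.eq

noncomputable instance : Mul (ParallelogramGroup G e) where
  mul := Quotient.map₂ (fun x y => (exists_isParallelogram G e x y).choose) <| by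
    intro x x' hx y y' hy
    have h := (exists_isParallelogram G e x y).choose_spec
    have h' := (exists_isParallelogram G e x' y').choose_spec
    exact (isParallelogram_congr_right h e).1
      (IsParallelogram.trans hy (IsParallelogram.trans hx h').flip).flip

theorem mk_mul_mk_eq_mk_iff {x y z : X} :
    mk G e x * mk G e y = mk G e z ↔ IsParallelogram G e x y z :=
  mk_eq_mk_iff.trans
    (isParallelogram_congr_right (exists_isParallelogram G e x y).choose_spec e).symm

protected theorem mul_comm (a b : ParallelogramGroup G e) : a * b = b * a := by
  obtain ⟨x, rfl⟩ := mk_surjective a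
  obtain ⟨y, rfl⟩ := mk_surjective b
  obtain ⟨z, hz⟩ := exists_isParallelogram G e x y
  rw [mk_mul_mk_eq_mk_iff.2 hz, mk_mul_mk_eq_mk_iff.2 hz.flip]

protected theorem mul_assoc (a b c : ParallelogramGroup G e) : a * b * c = a * (b * c) := by
  obtain ⟨x, rfl⟩ := mk_surjective a
  obtain ⟨y, rfl⟩ := mk_surjective b
  obtain ⟨z, rfl⟩ := mk_surjective c
  obtain ⟨xy, hxy⟩ := exists_isParallelogram G e x y
  obtain ⟨yz, hyz⟩ := exists_isParallelogram G e y z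
  obtain ⟨xyz, hxyz⟩ := exists_isParallelogram G e x yz
  have h : IsParallelogram G e xy z xyz := (hyz.flip.trans (hxy.symm.trans hxyz).flip).flip
  rw [mk_mul_mk_eq_mk_iff.2 hxy, mk_mul_mk_eq_mk_iff.2 hyz, mk_mul_mk_eq_mk_iff.2 hxyz,
    mk_mul_mk_eq_mk_iff.2 h]

protected theorem mul_mk_self (a : ParallelogramGroup G e) : a * mk G e e = a := by
  obtain ⟨x, rfl⟩ := mk_surjective a
  exact mk_mul_mk_eq_mk_iff.2 (isParallelogram_refl e x)

theorem exists_mul_eq_mk_self (a : ParallelogramGroup G e) :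
    ∃ b : ParallelogramGroup G e, b * a = mk G e e := by
  obtain ⟨x, rfl⟩ := mk_surjective a
  obtain ⟨y, hy⟩ := exists_isParallelogram G x e e
  exact ⟨mk G e y, mk_mul_mk_eq_mk_iff.2 hy.swap.flip⟩

noncomputable instance : CommGroup (ParallelogramGroup G e) where
  mul_assoc := ParallelogramGroup.mul_assoc
  one := mk G e e
  one_mul a := (ParallelogramGroup.mul_comm _ a).trans (ParallelogramGroup.mul_mk_self a)
  mul_one := ParallelogramGroup.mul_mk_self
  inv a := (exists_mul_eq_mk_self a).choose
  inv_mul_cancel a := (exists_mul_eq_mk_self a).choose_spec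
  mul_comm := ParallelogramGroup.mul_comm

theorem mk_smul (g : G) (x : X) : mk G e (g • x) = mk G e (g • e) * mk G e x :=
  (mk_mul_mk_eq_mk_iff.2 (isParallelogram_smul_smul e x g).flip).symm

instance : TopologicalSpace (ParallelogramGroup G e) :=
  inferInstanceAs (TopologicalSpace (Quotient (parallelogramSetoid G e)))

instance : CompactSpace (ParallelogramGroup G e) :=
  inferInstanceAs (CompactSpace (Quotient (parallelogramSetoid G e)))

theorem isClosed_parallelogramSetoid : IsClosed {p : X × X | parallelogramSetoid G e p.1 p.2} :=
  isClosed_setOf_isParallelogram.preimage (f := fun p : X × X => (e, p.1, e, p.2)) (by fun_prop)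

instance : T2Space (ParallelogramGroup G e) :=
  t2Space_quotient_of_isClosed isClosed_parallelogramSetoid

theorem isProperMap_mk : IsProperMap (mk G e) :=
  isProperMap_quotient_mk isClosed_parallelogramSetoid

theorem isClosed_graph_mul : IsClosed
    {p : (ParallelogramGroup G e × ParallelogramGroup G e) × ParallelogramGroup G e |
      p.1.1 * p.1.2 = p.2} := by
  have isClosed_parallelograms : IsClosed {p : (X × X) × X | IsParallelogram G e p.1.1 p.1.2 p.2} :=
    isClosed_setOf_isParallelogram.preimage (f := fun p : (X × X) × X => (e, p.1.1, p.1.2, p.2))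
      (by fun_prop)
  convert ((isProperMap_mk.prodMap isProperMap_mk).prodMap isProperMap_mk).isClosedMap _
    isClosed_parallelograms using 1
  ext ⟨⟨a, b⟩, c⟩
  constructor
  · obtain ⟨x, rfl⟩ := mk_surjective a
    obtain ⟨y, rfl⟩ := mk_surjective b
    obtain ⟨z, rfl⟩ := mk_surjective c
    exact fun h => ⟨((x, y), z), mk_mul_mk_eq_mk_iff.1 h, rfl⟩
  · rintro ⟨p, hp, hpabc⟩
    exact hpabc ▸ mk_mul_mk_eq_mk_iff.2 hp

instance : IsTopologicalGroup (ParallelogramGroup G e) :=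
  have : ContinuousMul (ParallelogramGroup G e) := ⟨continuous_of_isClosed_graph isClosed_graph_mul⟩
  { continuous_inv := continuous_of_isClosed_graph <| by
      simp only [inv_eq_iff_mul_eq_one]
      exact isClosed_eq continuous_mul continuous_const }

instance [SecondCountableTopology X] :
    TopologicalSpace.MetrizableSpace (ParallelogramGroup G e) :=
  metrizableSpace_of_surjective isProperMap_mk.continuous mk_surjective

end ParallelogramGroup

end ParallelogramGroup

section PowersAction

open MulAction
open Subgroup (zpowers)
open scoped IsMulCommutative

variable {X : Type*}

/-- The tautological action of the group of self-homeomorphisms. -/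
scoped instance homeomorphMulAction [TopologicalSpace X] : MulAction (X ≃ₜ X) X where
  smul T x := T x
  one_smul _ := rfl
  mul_smul _ _ _ := rfl

instance [TopologicalSpace X] : ContinuousConstSMul (X ≃ₜ X) X where
  continuous_const_smul T := T.continuous

theorem IsMinimalSystem.isMinimal [TopologicalSpace X] {T : X ≃ₜ X} (hT : IsMinimalSystem T) :
    IsMinimal (zpowers T) X where
  dense_orbit x := (hT x).mono <| Set.range_subset_iff.2 fun n => ⟨⟨T ^ n, n, rfl⟩, rfl⟩

theorem IsDistalSystem.isDistalAction [MetricSpace X] {T : X ≃ₜ X} (hT : IsDistalSystem T) :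
    IsDistalAction (zpowers T) X where
  eq_of_mem_closure_orbit x y z hz := by
    by_contra hxy
    have hpos := hT x y hxy
    set δ := ⨅ n : ℤ, dist ((T ^ n) x) ((T ^ n) y)
    have le_dist_orbit : δ ≤ dist z z :=
      mem_of_mem_closure_range hz (f := fun p => dist p.1 p.2) (by fun_prop) isClosed_Ici
        fun ⟨_, n, hn⟩ => hn ▸ ciInf_le ⟨0, Set.forall_mem_range.2 fun _ => dist_nonneg⟩ n
    exact hpos.not_ge (le_dist_orbit.trans_eq (dist_self z))

theorem mem_parallelograms_iff [TopologicalSpace X] {T : X ≃ₜ X} {x₀ x₁ x₂ x₃ : X} :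
    (x₀, x₁, x₂, x₃) ∈ parallelograms T ↔ IsParallelogram (zpowers T) x₀ x₁ x₂ x₃ := by
  refine iff_of_eq (congrArg ((x₀, x₁, x₂, x₃) ∈ closure ·) (Set.ext fun w => ⟨?_, ?_⟩))
  · rintro ⟨x, m, n, rfl⟩
    exact ⟨(x, ⟨T ^ m, m, rfl⟩, ⟨T ^ n, n, rfl⟩), by rw [zpow_add]; rfl⟩
  · rintro ⟨⟨x, ⟨_, m, rfl⟩, ⟨_, n, rfl⟩⟩, rfl⟩
    exact ⟨x, m, n, by rw [zpow_add]; rfl⟩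

theorem IsMinimalSystem.exists_mem_parallelograms [TopologicalSpace X] [CompactSpace X] [T2Space X]
    {T : X ≃ₜ X} (hT : IsMinimalSystem T) (x₀ x₁ x₂ : X) :
    ∃ x₃, (x₀, x₁, x₂, x₃) ∈ parallelograms T := by
  have := hT.isMinimal
  simpa only [mem_parallelograms_iff] using exists_isParallelogram (zpowers T) x₀ x₁ x₂

theorem mem_parallelograms_congr_right [MetricSpace X] [CompactSpace X] {T : X ≃ₜ X}
    (hmin : IsMinimalSystem T) (hdist : IsDistalSystem T) {x₀ x₁ x₂ x₃ y : X}
    (h : (x₀, x₁, x₂, x₃) ∈ parallelograms T) (e : X) :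
    (x₀, x₁, x₂, y) ∈ parallelograms T ↔ (e, x₃, e, y) ∈ parallelograms T := by
  have := hmin.isMinimal
  have := hdist.isDistalAction
  simp only [mem_parallelograms_iff] at h ⊢
  exact isParallelogram_congr_right h e

theorem mem_parallelograms_iff_exists_seq [MetricSpace X] [CompactSpace X] {T : X ≃ₜ X}
    (hmin : IsMinimalSystem T) (hdist : IsDistalSystem T) (x₀ x₁ x₂ x₃ : X) :
    (x₀, x₁, x₂, x₃) ∈ parallelograms T ↔
      ∃ m n : ℕ → ℤ,
        Tendsto (fun i => (T ^ m i) x₀) atTop (𝓝 x₁) ∧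
        Tendsto (fun i => (T ^ n i) x₀) atTop (𝓝 x₂) ∧
        Tendsto (fun i => (T ^ (m i + n i)) x₀) atTop (𝓝 x₃) := by
  have := hmin.isMinimal
  have := hdist.isDistalAction
  refine ⟨fun h => ?_, fun ⟨m, n, h₁, h₂, h₃⟩ => ?_⟩
  · obtain ⟨w, hw, hlim⟩ := mem_closure_iff_seq_limit.1
      (mem_parallelograms_iff.1 h).mem_closure_orbit_faceSubgroup
    have exists_exponents : ∀ i, ∃ m n : ℤ,
        (((T ^ m) x₀, (T ^ n) x₀), (T ^ (m + n)) x₀) = w i := fun i => by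
      obtain ⟨⟨⟨⟨⟨_, m, rfl⟩, ⟨_, n, rfl⟩⟩, g⟩, hg⟩, hw⟩ := hw i
      obtain rfl : (⟨T ^ m, m, rfl⟩ * ⟨T ^ n, n, rfl⟩ : zpowers T) = g := hg
      exact ⟨m, n, hw ▸ by rw [zpow_add]; rfl⟩
    choose m n hmn using exists_exponents
    obtain rfl := funext hmn
    exact ⟨m, n, hlim.fst_nhds.fst_nhds, hlim.fst_nhds.snd_nhds, hlim.snd_nhds⟩
  · exact mem_closure_of_tendsto
      (tendsto_const_nhds.prodMk_nhds (h₁.prodMk_nhds (h₂.prodMk_nhds h₃)))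
      (Eventually.of_forall fun i => ⟨x₀, m i, n i, rfl⟩)

end PowersAction

section Factors

variable {X : Type u} [TopologicalSpace X] {T : X ≃ₜ X}

theorem IsFactorMap.map_zpow {Y : Type v} [TopologicalSpace Y] {S : Y ≃ₜ Y} {p : X → Y}
    (hp : IsFactorMap T S p) (n : ℤ) (x : X) : p ((T ^ n) x) = (S ^ n) (p x) := by
  have map_inv (x : X) : p (T⁻¹ x) = S⁻¹ (p x) :=
    S.toEquiv.eq_symm_apply.2
      ((hp.semiconj (T⁻¹ x)).symm.trans (congrArg p (T.apply_symm_apply x)))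
  induction n generalizing x with
  | zero => rfl
  | succ n ih =>
    rw [zpow_add_one, zpow_add_one]
    exact (ih (T x)).trans (congrArg _ (hp.semiconj x))
  | pred n ih =>
    rw [zpow_sub_one, zpow_sub_one]
    exact (ih (T⁻¹ x)).trans (congrArg _ (map_inv x))

theorem mulLeft_zpow_apply {Z : Type*} [Group Z] [TopologicalSpace Z] [SeparatelyContinuousMul Z]
    (α : Z) (n : ℤ) (z : Z) : ((Homeomorph.mulLeft α) ^ n) z = α ^ n * z := by
  let mulLeftHom : Z →* (Z ≃ₜ Z) :=
    { toFun := Homeomorph.mulLeft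
      map_one' := Homeomorph.ext one_mul
      map_mul' := fun a b => Homeomorph.ext (mul_assoc a b) }
  exact DFunLike.congr_fun (_root_.map_zpow mulLeftHom α n).symm z

theorem isEquicontinuousSystem_mulLeft {Z : Type*} [Group Z] [MetricSpace Z] [CompactSpace Z]
    [IsTopologicalGroup Z] (α : Z) : IsEquicontinuousSystem (Homeomorph.mulLeft α) := by
  have hmul : UniformContinuous fun p : Z × Z => p.1 * p.2 :=
    CompactSpace.uniformContinuous_of_continuous continuous_mul
  rw [IsEquicontinuousSystem, Metric.uniformEquicontinuous_iff]
  intro ε hε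
  obtain ⟨δ, hδ, h⟩ := Metric.uniformContinuous_iff.1 hmul ε hε
  refine ⟨δ, hδ, fun x y hxy n => ?_⟩
  rw [mulLeft_zpow_apply, mulLeft_zpow_apply]
  exact h (a := (α ^ n, x)) (b := (α ^ n, y)) (by simpa [Prod.dist_eq] using hxy)

theorem IsFactorMap.eq_of_mem_parallelograms {Y : Type*} [MetricSpace Y] {S : Y ≃ₜ Y} {p : X → Y}
    (hp : IsFactorMap T S p) (hS : IsEquicontinuousSystem S) {w x y : X}
    (h : (w, x, w, y) ∈ parallelograms T) : p x = p y := by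
  refine eq_of_forall_dist_le fun ε hε => ?_
  obtain ⟨δ, hδ, dist_lt⟩ := Metric.uniformEquicontinuous_iff.1 hS ε hε
  have hcont := hp.continuous
  have isClosed_far : IsClosed {v : X × X × X × X | δ ≤ dist (p v.1) (p v.2.2.1)} :=
    isClosed_le (by fun_prop) (by fun_prop)
  have isClosed_near : IsClosed {v : X × X × X × X | dist (p v.2.1) (p v.2.2.2) ≤ ε} :=
    isClosed_le (by fun_prop) (by fun_prop)
  refine (closure_minimal ?_ (isClosed_far.union isClosed_near) h).resolve_left (by simpa using hδ)
  rintro _ ⟨x, m, n, rfl⟩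
  refine (le_or_gt δ (dist (p x) (p ((T ^ n) x)))).imp_right fun hlt => ?_
  have := (dist_lt _ _ hlt m).le
  rw [← hp.map_zpow, ← hp.map_zpow] at this
  rwa [zpow_add]

theorem IsFactorMap.mul_eq_one_of_mem_parallelograms {Z : Type*} [CommGroup Z] [TopologicalSpace Z]
    [T1Space Z] [IsTopologicalGroup Z] {α : Z} {π : X → Z}
    (hπ : IsFactorMap T (Homeomorph.mulLeft α) π) {x₀ x₁ x₂ x₃ : X}
    (h : (x₀, x₁, x₂, x₃) ∈ parallelograms T) : π x₀ * (π x₁)⁻¹ * (π x₂)⁻¹ * π x₃ = 1 := by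
  have hcont := hπ.continuous
  have isClosed_cond : IsClosed {w : X × X × X × X |
      π w.1 * (π w.2.1)⁻¹ * (π w.2.2.1)⁻¹ * π w.2.2.2 = 1} :=
    isClosed_singleton.preimage (by fun_prop)
  refine closure_minimal ?_ isClosed_cond h
  rintro _ ⟨x, m, n, rfl⟩
  simp only [Set.mem_ofPred_eq, hπ.map_zpow, mulLeft_zpow_apply]
  rw [zpow_add]
  generalize α ^ m = b, α ^ n = c, π x = a
  rw [mul_inv_rev b a, mul_inv_cancel_left, ← mul_inv_rev, inv_mul_eq_one, mul_assoc b,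
    mul_comm b]

theorem IsFactorMap.exists_isFactorMap_of_eq_imp_eq [CompactSpace X] {Y Z : Type*}
    [TopologicalSpace Y] [TopologicalSpace Z] [T2Space Z] {R : Z ≃ₜ Z} {S : Y ≃ₜ Y} {π : X → Z}
    {p : X → Y} (hπ : IsFactorMap T R π) (hp : IsFactorMap T S p)
    (h : ∀ x y, π x = π y → p x = p y) : ∃ q : Z → Y, IsFactorMap R S q ∧ ∀ x, q (π x) = p x := by
  have π_quotient := hπ.continuous.isClosedMap.isQuotientMap hπ.continuous hπ.surjective
  obtain ⟨s, hs⟩ := hπ.surjective.hasRightInverse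
  have hq (x : X) : p (s (π x)) = p x := h _ _ (hs (π x))
  refine ⟨p ∘ s, ⟨?_, ?_, ?_⟩, hq⟩
  · exact π_quotient.continuous_iff.2 (hp.continuous.congr fun x => (hq x).symm)
  · exact fun y => (hp.surjective y).imp' π fun x hx => (hq x).trans hx
  · refine hπ.surjective.forall.2 fun x => ?_
    rw [← hπ.semiconj]
    exact (hq (T x)).trans ((hp.semiconj x).trans (congrArg S (hq x).symm))

end Factors

section MaximalFactor

open Subgroup (zpowers)
open scoped IsMulCommutative

variable {X : Type u} [MetricSpace X] [CompactSpace X] {T : X ≃ₜ X}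

theorem exists_isMaximalEquicontinuousFactor (hmin : IsMinimalSystem T)
    (hdist : IsDistalSystem T) (e : X) :
    ∃ (Z : Type u) (_ : CommGroup Z) (_ : MetricSpace Z) (_ : CompactSpace Z)
      (_ : IsTopologicalGroup Z) (α : Z) (π : X → Z),
      IsMaximalEquicontinuousFactor T (Homeomorph.mulLeft α) π ∧
        ∀ x y, π x = π y → (e, x, e, y) ∈ parallelograms T := by
  have := hmin.isMinimal
  have := hdist.isDistalAction
  let := TopologicalSpace.metrizableSpaceMetric (ParallelogramGroup (zpowers T) e)
  let π := ParallelogramGroup.mk (zpowers T) e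
  have hπ : IsFactorMap T (Homeomorph.mulLeft (π (T e))) π :=
    { continuous := ParallelogramGroup.isProperMap_mk.continuous
      surjective := ParallelogramGroup.mk_surjective
      semiconj := ParallelogramGroup.mk_smul (⟨T, Subgroup.mem_zpowers T⟩ : zpowers T) }
  have mem_of_eq (x y : X) (h : π x = π y) : (e, x, e, y) ∈ parallelograms T :=
    mem_parallelograms_iff.2 (ParallelogramGroup.mk_eq_mk_iff.1 h)
  refine ⟨ParallelogramGroup (zpowers T) e, inferInstance, inferInstance, inferInstance,
    inferInstance, π (T e), π, ⟨hπ, isEquicontinuousSystem_mulLeft _, ?_⟩, mem_of_eq⟩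
  exact fun Y _ _ S p hp hS => hπ.exists_isFactorMap_of_eq_imp_eq hp fun x y hxy =>
    hp.eq_of_mem_parallelograms hS (mem_of_eq x y hxy)

end MaximalFactor

end TopDyn

/-- For a minimal distal system `(X, T)`: the maximal equicontinuous factor exists and is a
rotation on a compact abelian group; however it is realized as such a rotation, it characterizes
the parallelograms; and the parallelograms are characterized by sequences. -/
theorem mainTheorem6 {X : Type u} [MetricSpace X] [CompactSpace X] [Nonempty X]
    (T : X ≃ₜ X) (hmin : TopDyn.IsMinimalSystem T) (hdist : TopDyn.IsDistalSystem T) :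
    (∃ (Z : Type u) (_ : CommGroup Z) (_ : MetricSpace Z) (_ : CompactSpace Z)
        (_ : IsTopologicalGroup Z) (α : Z) (π : X → Z),
        TopDyn.IsMaximalEquicontinuousFactor T (Homeomorph.mulLeft α) π) ∧
    (∀ (Z : Type v) [CommGroup Z] [MetricSpace Z] [CompactSpace Z] [IsTopologicalGroup Z]
        (α : Z) (π : X → Z),
        TopDyn.IsMaximalEquicontinuousFactor T (Homeomorph.mulLeft α) π →
        ∀ x₀ x₁ x₂ x₃ : X, (x₀, x₁, x₂, x₃) ∈ TopDyn.parallelograms T ↔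
          π x₀ * (π x₁)⁻¹ * (π x₂)⁻¹ * π x₃ = 1) ∧
    (∀ x₀ x₁ x₂ x₃ : X, (x₀, x₁, x₂, x₃) ∈ TopDyn.parallelograms T ↔
        ∃ m n : ℕ → ℤ,
          Tendsto (fun i => (T ^ m i) x₀) atTop (𝓝 x₁) ∧
          Tendsto (fun i => (T ^ n i) x₀) atTop (𝓝 x₂) ∧
          Tendsto (fun i => (T ^ (m i + n i)) x₀) atTop (𝓝 x₃)) := by
  obtain ⟨e⟩ := ‹Nonempty X›
  obtain ⟨Z₀, instG, instM, instC, instT, α₀, π₀, hπ₀, mem_of_eq⟩ :=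
    TopDyn.exists_isMaximalEquicontinuousFactor hmin hdist e
  refine ⟨⟨Z₀, instG, instM, instC, instT, α₀, π₀, hπ₀⟩, fun Z _ _ _ _ α π hπ x₀ x₁ x₂ x₃ => ?_,
    TopDyn.mem_parallelograms_iff_exists_seq hmin hdist⟩
  refine ⟨hπ.isFactorMap.mul_eq_one_of_mem_parallelograms, fun h => ?_⟩
  obtain ⟨y, hy⟩ := hmin.exists_mem_parallelograms x₀ x₁ x₂
  have hπy : π y = π x₃ :=
    mul_left_cancel ((hπ.isFactorMap.mul_eq_one_of_mem_parallelograms hy).trans h.symm)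
  obtain ⟨q, -, hq⟩ := hπ.maximal Z₀ _ π₀ hπ₀.isFactorMap hπ₀.equicontinuous
  have hπ₀y : π₀ y = π₀ x₃ := by rw [← hq, ← hq, hπy]
  exact (TopDyn.mem_parallelograms_congr_right hmin hdist hy e).2 (mem_of_eq y x₃ hπ₀y)
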